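/- Let $d\ge 0$ and let $\mu_0=e^{-V_0}$ and $\pi=e^{-V_\pi}$, with $V_0,V_\pi\in C^1(\mathbb R^d)$, be two distinct probability densities on $\mathbb R^d$ such that $\log\frac{\pi}{\mu_0}$ is square integrable with respect to $\mu_0$ and to $\pi$. For $\lambda\in[0,1]$ let $\pi_\lambda\propto\mu_0^{1-\lambda}\pi^{\lambda}$ be the normalised geometric mixture, and on $\mathcal P(\mathbb R^d)\times[0,1]$ (with the product of the topology of weak convergence and the Euclidean topology) put $$\mathcal F(\mu,\lambda)=D_{\mathrm{KL}}(\mu\|\pi_\lambda)+D_{\mathrm{KL}}(\pi_\lambda\|\pi).$$ Consider the gradient flow of $\mathcal F$ for the Fisher--Rao metric in $\mu$ and the Euclidean metric in $\lambda\in[0,1]$, i.e. for $t\ge 0$ and $x\in\mathbb R^d$ $$\partial_t\mu_t(x)=-\mu_t(x)\Big(\log\frac{\mu_t(x)}{\pi_{\lambda_t}(x)}-\mathbb E_{\mu_t}\Big[\log\frac{\mu_t}{\pi_{\lambda_t}}\Big]\Big),$$ $$\dot\lambda_t=\int\mu_t\log\frac{\pi}{\mu_0}\,dx-\int\pi_{\lambda_t}\log\frac{\pi}{\mu_0}\,dx+(1-\lambda_t)\,\mathrm{Var}_{\pi_{\lambda_t}}\Big(\log\frac{\mu_0}{\pi}\Big),$$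 where $\mu_t$ is a positive probability density, $\lambda_t\in[0,1]$, and the expectations under $\mu_t$ exist, with initial states in the set $\mathcal M=\{(\pi_\beta,\lambda):\beta,\lambda\in[0,1]\}$, which contains all the states $(\mu_0,\lambda)$. Then 1. $(\pi,1)$ is the unique minimiser of $\mathcal F$ on $\mathcal P(\mathbb R^d)\times[0,1]$, and $\mathcal F(\pi,1)=0$; 2. from every state of $\mathcal M$ there starts a solution defined for all $t\ge0$; 3. $(\pi,1)$ is asymptotically stable: for every neighbourhood $U$ of $(\pi,1)$ there is a neighbourhood $V$ of $(\pi,1)$ such that every solution that starts in $V\cap\mathcal M$ stays in $U$ for all $t\ge 0$, and for some neighbourhood $V$ every solution that starts in $V\cap\mathcal M$ converges to $(\pi,1)$; 4. every solution that starts in $\mathcal M$, in particular every solution with $\mu_t|_{t=0}=\mu_0$ and any initial $\lambda\in[0,1]$, satisfies $(\mu_t,\lambda_t)\to(\pi,1)$ as $t\to\infty$. -/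

import Mathlib

open MeasureTheory ProbabilityTheory InformationTheory Filter Topology
open scoped ENNReal unitInterval

noncomputable section

namespace TemperedFR

variable {d : ℕ}

/-- The density `exp (-V)` with potential `V`. -/
def gibbs (V : EuclideanSpace ℝ (Fin d) → ℝ) (x : EuclideanSpace ℝ (Fin d)) : ℝ :=
  Real.exp (-V x)

/-- The measure on `ℝ^d` with Lebesgue density `f` (used for nonnegative `f`). -/
def densityMeasure (f : EuclideanSpace ℝ (Fin d) → ℝ) : Measure (EuclideanSpace ℝ (Fin d)) :=
  volume.withDensity (fun x => ENNReal.ofReal (f x))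

/-- The density of the geometric mixture `π_l ∝ p₀ ^ (1 - l) * p ^ l`. -/
def temperedDensity (p₀ p : EuclideanSpace ℝ (Fin d) → ℝ) (l : ℝ)
    (x : EuclideanSpace ℝ (Fin d)) : ℝ :=
  p₀ x ^ (1 - l) * p x ^ l / ∫ y, p₀ y ^ (1 - l) * p y ^ l

/-- The geometric mixture `π_l` as a measure. -/
def temperedMeasure (p₀ p : EuclideanSpace ℝ (Fin d) → ℝ) (l : ℝ) :
    Measure (EuclideanSpace ℝ (Fin d)) :=
  densityMeasure (temperedDensity p₀ p l)

/-- `log (p / p₀)`. -/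
def logRatio (p₀ p : EuclideanSpace ℝ (Fin d) → ℝ) (x : EuclideanSpace ℝ (Fin d)) : ℝ :=
  Real.log (p x / p₀ x)

/-- The state space `𝒫(ℝ^d) × [0,1]`, with the product of the topology of weak convergence and
the Euclidean topology. -/
abbrev State (d : ℕ) : Type := ProbabilityMeasure (EuclideanSpace ℝ (Fin d)) × I

/-- The functional `F(μ, l) = KL(μ ‖ π_l) + KL(π_l ‖ π)`, where `π` has density `p`. -/
def functional (p₀ p : EuclideanSpace ℝ (Fin d) → ℝ) (z : State d) : ℝ≥0∞ :=
  klDiv (z.1 : Measure (EuclideanSpace ℝ (Fin d))) (temperedMeasure p₀ p z.2) +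
    klDiv (temperedMeasure p₀ p z.2) (densityMeasure p)

/-- `γ t = (μ_t, l_t)`, `t ≥ 0`, is a global solution of the coupled gradient flow of the
functional for the Fisher–Rao metric in `μ` and the Euclidean metric in `l`: the measures `μ_t`
have positive densities `ρ t`, the expectations in the two equations exist, and
* `∂ₜ ρ_t(x) = - ρ_t(x) (log (ρ_t(x) / π_{l_t}(x)) - E_{μ_t}[log (ρ_t / π_{l_t})])`,
* `l_t' = E_{μ_t}[log (p/p₀)] - E_{π_{l_t}}[log (p/p₀)] + (1 - l_t) Var_{π_{l_t}}(log (p₀/p))`.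

The values of `γ` at negative times play no role. -/
def IsGradientFlow (p₀ p : EuclideanSpace ℝ (Fin d) → ℝ) (γ : ℝ → State d) : Prop :=
  ∃ ρ : ℝ → EuclideanSpace ℝ (Fin d) → ℝ,
    (∀ t, 0 ≤ t → Measurable (ρ t) ∧ (∀ x, 0 < ρ t x) ∧
      ((γ t).1 : Measure (EuclideanSpace ℝ (Fin d))) = densityMeasure (ρ t)) ∧
    (∀ t, 0 ≤ t →
      Integrable (fun y => Real.log (ρ t y / temperedDensity p₀ p (γ t).2 y))
        ((γ t).1 : Measure (EuclideanSpace ℝ (Fin d))) ∧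
      Integrable (logRatio p₀ p) ((γ t).1 : Measure (EuclideanSpace ℝ (Fin d)))) ∧
    (∀ t, 0 ≤ t → ∀ x,
      HasDerivWithinAt (fun s => ρ s x)
        (-(ρ t x) * (Real.log (ρ t x / temperedDensity p₀ p (γ t).2 x) -
          ∫ y, Real.log (ρ t y / temperedDensity p₀ p (γ t).2 y)
            ∂((γ t).1 : Measure (EuclideanSpace ℝ (Fin d)))))
        (Set.Ici 0) t) ∧
    (∀ t, 0 ≤ t →
      HasDerivWithinAt (fun s => ((γ s).2 : ℝ))
        ((∫ y, logRatio p₀ p y ∂((γ t).1 : Measure (EuclideanSpace ℝ (Fin d)))) -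
          (∫ y, logRatio p₀ p y ∂(temperedMeasure p₀ p (γ t).2)) +
          (1 - ((γ t).2 : ℝ)) *
            variance (fun y => Real.log (p₀ y / p y)) (temperedMeasure p₀ p (γ t).2))
        (Set.Ici 0) t)

/-- The phase space of the flow: the states `(π_b, l)` with `b, l ∈ [0,1]`. It contains all the
states `(μ₀, l)` (take `b = 0`, where `μ₀` has density `p₀`) and the state `(π, 1)`. -/
def phaseSpace (p₀ p : EuclideanSpace ℝ (Fin d) → ℝ) : Set (State d) :=
  {z | ∃ b ∈ Set.Icc (0 : ℝ) 1,
    (z.1 : Measure (EuclideanSpace ℝ (Fin d))) = temperedMeasure p₀ p b}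

/-- The solutions of the gradient flow that start in the phase space. -/
def trajectories (p₀ p : EuclideanSpace ℝ (Fin d) → ℝ) : Set (ℝ → State d) :=
  {γ | IsGradientFlow p₀ p γ ∧ γ 0 ∈ phaseSpace p₀ p}

/-- Asymptotic stability of a point `x` for a set `S` of trajectories `γ : [0,∞) → X`: Lyapunov
stability together with local attractivity. -/
structure IsAsymptoticallyStable {X : Type*} [TopologicalSpace X] (S : Set (ℝ → X)) (x : X) :
    Prop where
  stable : ∀ U ∈ 𝓝 x, ∃ V ∈ 𝓝 x, ∀ γ ∈ S, γ 0 ∈ V → ∀ t, 0 ≤ t → γ t ∈ U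
  attractive : ∃ V ∈ 𝓝 x, ∀ γ ∈ S, γ 0 ∈ V → Tendsto γ atTop (𝓝 x)

end TemperedFR

end

open MeasureTheory ProbabilityTheory InformationTheory Filter Topology
open scoped ENNReal unitInterval

noncomputable section

namespace TemperedFR

/-! ### Two tools for ordinary differential equations -/

/-! Write `g = log (π/μ₀)`, so that `π_b = μ₀ e^{bg} / Z(b)` is an exponential family. After
division by `μ_t`, the Fisher–Rao equation says that `log (μ_t/μ₀)` relaxes linearly towards `l_t
g`, up to terms constant in `x`. Hence a solution that starts at some `π_b` stays in the family,
with `b' = l - b` (`exists_reducedFlow_of_isGradientFlow`), and conversely every planar solution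
gives a gradient flow. With `m(b)` and `v(b)` the mean and the variance of `g` under `π_b`, the
other equation becomes `l' = m(b) - m(l) + (1 - l) v(l)`. Square integrability of `g` under both
endpoints makes `m' = v` continuous on `[0,1]`, and distinctness of the densities makes `v`
positive, so `0 < c ≤ v ≤ C`.

Put `x = 1 - b`, `y = 1 - l`. Then `x' = y - x` is negative where `x` dominates `a y`, for any `a >
1`; where `a y` dominates `x`, the Lipschitz bound on `m` gives `y' ≤ (C(a - 1) - c) y`, negative
for `a` close to 1. So `max x (a y)` decays exponentially (`exists_exponential_decay`). This
estimate and the weak continuity of `b ↦ π_b` give stability and convergence.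

Since `v` is only known to be continuous, the planar field need not be Lipschitz: existence comes
from Peano's theorem, and the stability and convergence arguments apply to every solution without
uniqueness. The minimiser is the only common zero of the two divergences, because `m` is injective.
-/

lemma eventually_slope_lt {P : ℝ → ℝ} {P' t r : ℝ} (ht : 0 ≤ t)
    (hP : HasDerivWithinAt P P' (Set.Ici 0) t) (hr : P' < r) :
    ∀ᶠ z in 𝓝[>] t, slope P t z < r := by
  have h : HasDerivWithinAt P P' (Set.Ioi t) t :=
    hP.mono fun z hz => ht.trans (le_of_lt hz)
  rw [hasDerivWithinAt_iff_tendsto_slope' (by simp)] at h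
  exact h.eventually (gt_mem_nhds hr)

/-- If each of two functions is non-increasing wherever it dominates the other one, then their
maximum is bounded by its initial value. -/
theorem max_le_of_deriv_nonpos {P Q P' Q' : ℝ → ℝ}
    (hP : ∀ t, 0 ≤ t → HasDerivWithinAt P (P' t) (Set.Ici 0) t)
    (hQ : ∀ t, 0 ≤ t → HasDerivWithinAt Q (Q' t) (Set.Ici 0) t)
    (hPQ : ∀ t, 0 ≤ t → Q t ≤ P t → P' t ≤ 0)
    (hQP : ∀ t, 0 ≤ t → P t ≤ Q t → Q' t ≤ 0) {t : ℝ} (ht : 0 ≤ t) :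
    max (P t) (Q t) ≤ max (P 0) (Q 0) := by
  have hcP : ContinuousOn P (Set.Ici 0) := fun s hs => (hP s hs).continuousWithinAt
  have hcQ : ContinuousOn Q (Set.Ici 0) := fun s hs => (hQ s hs).continuousWithinAt
  have hsub : Set.Icc 0 t ⊆ Set.Ici 0 := Set.Icc_subset_Ici_self
  refine image_le_of_liminf_slope_right_le_deriv_boundary (f := fun s => max (P s) (Q s))
    (B := fun _ => max (P 0) (Q 0)) (B' := fun _ => 0) (a := 0) (b := t)
    ((hcP.mono hsub).sup (hcQ.mono hsub)) le_rfl continuousOn_const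
    (fun s _ => hasDerivWithinAt_const _ _ _) ?_ (Set.right_mem_Icc.2 ht)
  intro s hs r hr
  have hs0 := hs.1
  -- Where one function is strictly larger, the maximum coincides with it on a right neighbourhood.
  have key : ∀ {A B : ℝ → ℝ} {A' : ℝ}, HasDerivWithinAt A A' (Set.Ici 0) s → A' ≤ 0 →
      ContinuousWithinAt B (Set.Ici 0) s → B s < A s →
      ∀ᶠ z in 𝓝[>] s, slope (fun s => max (A s) (B s)) s z < r := by
    intro A B A' hA hA' hB hlt
    have h1 : ContinuousWithinAt A (Set.Ioi s) s :=
      hA.continuousWithinAt.mono fun z hz => hs0.trans (le_of_lt hz)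
    have h2 : ContinuousWithinAt B (Set.Ioi s) s :=
      hB.mono fun z hz => hs0.trans (le_of_lt hz)
    filter_upwards [h2.eventually_lt h1 hlt, eventually_slope_lt hs0 hA (hA'.trans_lt hr)]
      with z hz1 hz2
    simpa [slope_def_field, max_eq_left hz1.le, max_eq_left hlt.le] using hz2
  apply Eventually.frequently
  rcases lt_trichotomy (Q s) (P s) with h | h | h
  · exact key (hP s hs0) (hPQ s hs0 h.le) (hcQ s hs0) h
  -- At a tie both derivatives are nonpositive, so both slopes are below `r`, whichever function
  -- realises the maximum at `z`.
  · filter_upwards [eventually_slope_lt hs0 (hP s hs0) ((hPQ s hs0 h.le).trans_lt hr),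
      eventually_slope_lt hs0 (hQ s hs0) ((hQP s hs0 h.ge).trans_lt hr),
      self_mem_nhdsWithin] with z h1 h2 hz
    have hz' : 0 < z - s := sub_pos.2 hz
    rw [slope_def_field, div_lt_iff₀ hz'] at h1 h2 ⊢
    simp only [h, max_self] at h1 h2 ⊢
    rcases max_choice (P z) (Q z) with h' | h' <;> rw [h'] <;> assumption
  · simpa only [max_comm] using key (hQ s hs0) (hQP s hs0 h.le) (hcP s hs0) h

/-- A barrier argument: the constant `c` plays the role of the second function. The sign is needed
only at or beyond the barrier, so invariance of `[0,1]` follows without uniqueness of solutions. -/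
theorem le_of_deriv_nonpos {P P' : ℝ → ℝ} {c : ℝ}
    (hP : ∀ t, 0 ≤ t → HasDerivWithinAt P (P' t) (Set.Ici 0) t)
    (hP' : ∀ t, 0 ≤ t → c ≤ P t → P' t ≤ 0) (h0 : P 0 ≤ c) {t : ℝ} (ht : 0 ≤ t) :
    P t ≤ c := by
  have := max_le_of_deriv_nonpos hP (fun t _ => hasDerivWithinAt_const t _ c) hP'
    (fun _ _ _ => le_rfl) ht
  rw [max_eq_right h0] at this
  exact (le_max_left _ _).trans this

theorem ge_of_deriv_nonneg {P P' : ℝ → ℝ} {c : ℝ}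
    (hP : ∀ t, 0 ≤ t → HasDerivWithinAt P (P' t) (Set.Ici 0) t)
    (hP' : ∀ t, 0 ≤ t → P t ≤ c → 0 ≤ P' t) (h0 : c ≤ P 0) {t : ℝ} (ht : 0 ≤ t) :
    c ≤ P t := by
  have := le_of_deriv_nonpos (P := fun t => -P t) (c := -c) (fun t ht => (hP t ht).neg)
    (fun t ht h => by simpa using hP' t ht (by simpa using h)) (by simpa using h0) ht
  simpa using this

/-! ### Peano's existence theorem via Euler schemes -/

section Peano

lemma exists_ultrafilter_lim {E : Type*} [NormedAddCommGroup E] [ProperSpace E]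
    (𝒰 : Ultrafilter ℕ) (y : ℕ → E) (x₀ : E) (R : ℝ)
    (hy : ∀ n, ‖y n - x₀‖ ≤ R) : ∃ x, Tendsto y 𝒰 (𝓝 x) := by
  have hc : IsCompact (Metric.closedBall x₀ R) := isCompact_closedBall x₀ R
  obtain ⟨x, -, hx⟩ := hc.ultrafilter_le_nhds (𝒰.map y) (by
    simp only [le_principal_iff]
    exact Ultrafilter.mem_map.2 (Filter.univ_mem' fun n => by
      simpa [dist_eq_norm] using hy n))
  exact ⟨x, hx⟩

variable {E : Type*} [NormedAddCommGroup E] [NormedSpace ℝ E]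

/-- The explicit Euler scheme with step size `h` for `x' = F x`. -/
def eulerScheme (F : E → E) (x₀ : E) (h : ℝ) : ℕ → E
  | 0 => x₀
  | k + 1 => eulerScheme F x₀ h k + h • F (eulerScheme F x₀ h k)

lemma norm_eulerScheme_sub_le {F : E → E} {K : ℝ} (hK : ∀ x, ‖F x‖ ≤ K) (x₀ : E) {h : ℝ}
    (hh : 0 ≤ h) (k j : ℕ) :
    ‖eulerScheme F x₀ h (k + j) - eulerScheme F x₀ h k‖ ≤ j * h * K := by
  induction j with
  | zero => simp
  | succ j ih =>
    rw [← add_assoc, eulerScheme, add_sub_right_comm]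
    refine (norm_add_le _ _).trans ?_
    rw [norm_smul, Real.norm_of_nonneg hh]
    have := mul_le_mul_of_nonneg_left (hK (eulerScheme F x₀ h (k + j))) hh
    push_cast
    linarith

/-- The `j` steps stay within `δ` of their starting point, so each increment differs from `h • F` at
that point by at most `h * ε`. -/
lemma norm_eulerScheme_sub_sub_le {F : E → E} {K : ℝ} (hK : ∀ x, ‖F x‖ ≤ K) (x₀ : E) {h : ℝ}
    (hh : 0 ≤ h) {ε δ : ℝ} (hF : ∀ x y, ‖x - y‖ < δ → ‖F x - F y‖ ≤ ε) (k j : ℕ)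
    (hj : j * h * K < δ) :
    ‖eulerScheme F x₀ h (k + j) - eulerScheme F x₀ h k - (j * h) • F (eulerScheme F x₀ h k)‖
      ≤ j * h * ε := by
  induction j with
  | zero => simp
  | succ j ih =>
    have hK0 : 0 ≤ K := (norm_nonneg _).trans (hK 0)
    have hj' : j * h * K < δ := by
      refine lt_of_le_of_lt ?_ hj
      push_cast
      gcongr
      linarith
    have h1 := ih hj'
    have h2 := hF _ _ ((norm_eulerScheme_sub_le hK x₀ hh k j).trans_lt hj')
    rw [← add_assoc, eulerScheme]
    set a := eulerScheme F x₀ h (k + j)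
    set b := eulerScheme F x₀ h k
    have e : a + h • F a - b - (((j + 1 : ℕ) : ℝ) * h) • F b =
        (a - b - (j * h) • F b) + h • (F a - F b) := by
      push_cast
      module
    rw [e]
    refine (norm_add_le _ _).trans ?_
    rw [norm_smul, Real.norm_of_nonneg hh]
    have := mul_le_mul_of_nonneg_left h2 hh
    push_cast
    linarith

/-- **Peano's theorem** for a bounded uniformly continuous vector field: existence of a global
forward solution. -/
theorem exists_forward_solution [ProperSpace E] {F : E → E} (hF : UniformContinuous F) {K : ℝ}
    (hK : ∀ x, ‖F x‖ ≤ K) (x₀ : E) :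
    ∃ x : ℝ → E, x 0 = x₀ ∧ ∀ t, 0 ≤ t → HasDerivWithinAt x (F (x t)) (Set.Ici 0) t := by
  have hK0 : 0 ≤ K := (norm_nonneg _).trans (hK 0)
  let h : ℕ → ℝ := fun n => ((n : ℝ) + 1)⁻¹
  have hh : ∀ n, 0 ≤ h n := fun n => by positivity
  let k : ℕ → ℝ → ℕ := fun n t => ⌊t * ((n : ℝ) + 1)⌋₊
  let Y : ℕ → ℝ → E := fun n t => eulerScheme F x₀ (h n) (k n t)
  have hk : ∀ t, 0 ≤ t → Tendsto (fun n => (k n t : ℝ) * h n) atTop (𝓝 t) := fun t ht =>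
    (tendsto_nat_floor_mul_div_atTop ht).comp
      (tendsto_natCast_atTop_atTop.atTop_add (tendsto_const_nhds (x := (1 : ℝ))))
  have hkmono : ∀ n s t, s ≤ t → k n s ≤ k n t := fun n s t hst =>
    Nat.floor_mono (by gcongr)
  have hbdd : ∀ t n, ‖Y n t - x₀‖ ≤ |t| * K := by
    intro t n
    have h1 := norm_eulerScheme_sub_le hK x₀ (hh n) 0 (k n t)
    rw [zero_add] at h1
    refine h1.trans ?_
    gcongr
    have h2 : (k n t : ℝ) ≤ |t| * (n + 1) :=
      calc (k n t : ℝ) ≤ (⌊|t| * ((n : ℝ) + 1)⌋₊ : ℝ) := by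
            exact Nat.cast_le.2 (hkmono n t |t| (le_abs_self t))
        _ ≤ |t| * (n + 1) := Nat.floor_le (by positivity)
    calc (k n t : ℝ) * h n ≤ |t| * (n + 1) * h n := by gcongr
      _ = |t| := by simp only [h]; field_simp
  -- A limit along one fixed ultrafilter exists at every time simultaneously, which replaces the
  -- extraction of a subsequence by Arzelà–Ascoli.
  let 𝒰 : Ultrafilter ℕ := hyperfilter ℕ
  have h𝒰 : (𝒰 : Filter ℕ) ≤ atTop := Nat.hyperfilter_le_atTop
  choose x hx using fun t => exists_ultrafilter_lim 𝒰 (fun n => Y n t) x₀ _ (hbdd t)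
  have hj : ∀ s t, 0 ≤ s → s ≤ t →
      Tendsto (fun n => ((k n t - k n s : ℕ) : ℝ) * h n) 𝒰 (𝓝 (t - s)) := by
    intro s t hs hst
    refine Tendsto.mono_left ?_ h𝒰
    refine ((hk t (hs.trans hst)).sub (hk s hs)).congr fun n => ?_
    rw [Nat.cast_sub (hkmono n s t hst), sub_mul]
  have hY : ∀ n s t, s ≤ t →
      Y n t = eulerScheme F x₀ (h n) (k n s + (k n t - k n s)) := fun n s t hst => by
    rw [Nat.add_sub_cancel' (hkmono n s t hst)]
  have hlip : ∀ s t, 0 ≤ s → s ≤ t → ‖x t - x s‖ ≤ (t - s) * K := by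
    intro s t hs hst
    refine le_of_tendsto_of_tendsto ((hx t).sub (hx s)).norm ((hj s t hs hst).mul_const K)
      (Eventually.of_forall fun n => ?_)
    dsimp only
    rw [hY n s t hst]
    exact norm_eulerScheme_sub_le hK x₀ (hh n) _ _
  have hmain : ∀ ε > 0, ∃ δ > 0, (∀ x y, ‖x - y‖ < δ → ‖F x - F y‖ ≤ ε) ∧
      ∀ s t, 0 ≤ s → s ≤ t → (t - s) * K < δ →
        ‖x t - x s - (t - s) • F (x s)‖ ≤ (t - s) * ε := by
    intro ε hε
    obtain ⟨δ, hδ, hδF⟩ := Metric.uniformContinuous_iff.1 hF ε hε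
    have hδF' : ∀ x y, ‖x - y‖ < δ → ‖F x - F y‖ ≤ ε := fun x y hxy => by
      have := hδF (a := x) (b := y) (by rwa [dist_eq_norm])
      rw [dist_eq_norm] at this
      exact this.le
    refine ⟨δ, hδ, hδF', fun s t hs hst hlt => ?_⟩
    have hjt := hj s t hs hst
    refine le_of_tendsto_of_tendsto
      (((hx t).sub (hx s)).sub (hjt.smul ((hF.continuous.tendsto _).comp (hx s)))).norm
      (hjt.mul_const ε) ?_
    filter_upwards [(hjt.mul_const K).eventually (gt_mem_nhds hlt)] with n hn
    dsimp only [Function.comp]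
    rw [hY n s t hst]
    exact norm_eulerScheme_sub_sub_le hK x₀ (hh n) hδF' _ _ hn
  refine ⟨x, ?_, fun t ht => ?_⟩
  · refine tendsto_nhds_unique (hx 0) ?_
    have : ∀ n, Y n 0 = x₀ := fun n => by simp [Y, k, eulerScheme]
    simp only [this]
    exact tendsto_const_nhds
  · rw [hasDerivWithinAt_iff_isLittleO, Asymptotics.isLittleO_iff]
    intro ε hε
    obtain ⟨δ, hδ, h1, h2⟩ := hmain (ε / 2) (half_pos hε)
    -- `K + 1` rather than `K`, because `K` may vanish.
    have hη : 0 < δ / (K + 1) := by positivity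
    have hsmall : ∀ r, r < δ / (K + 1) → 0 ≤ r → r * K < δ := fun r hr hr0 => by
      rw [lt_div_iff₀ (by positivity)] at hr
      nlinarith
    filter_upwards [self_mem_nhdsWithin,
      mem_nhdsWithin_of_mem_nhds (Metric.ball_mem_nhds t hη)] with r hr hrt
    rw [Metric.mem_ball, Real.dist_eq] at hrt
    have hr0 : 0 ≤ r := hr
    rw [Real.norm_eq_abs]
    rcases le_total t r with htr | htr
    · rw [abs_of_nonneg (sub_nonneg.2 htr)] at hrt ⊢
      have := h2 t r ht htr (hsmall _ hrt (sub_nonneg.2 htr))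
      have h3 : 0 ≤ (r - t) * ε := mul_nonneg (sub_nonneg.2 htr) hε.le
      linarith
    -- The increment estimate is based at the left endpoint `r`; moving the base to `t` costs the
    -- second `ε / 2`.
    · rw [abs_of_nonpos (sub_nonpos.2 htr), neg_sub] at hrt ⊢
      have hs := hsmall _ hrt (sub_nonneg.2 htr)
      have h3 := h2 r t hr0 htr hs
      have h4 := h1 _ _ ((hlip r t hr0 htr).trans_lt hs)
      have e : x r - x t - (r - t) • F (x t) =
          -(x t - x r - (t - r) • F (x r)) + (t - r) • (F (x t) - F (x r)) := by module
      rw [e]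
      refine (norm_add_le _ _).trans ?_
      rw [norm_neg, norm_smul, Real.norm_of_nonneg (sub_nonneg.2 htr)]
      have := mul_le_mul_of_nonneg_left h4 (sub_nonneg.2 htr)
      linarith

end Peano

variable {d : ℕ}

/-! ### Measures with a Lebesgue density -/

lemma integral_densityMeasure {f : EuclideanSpace ℝ (Fin d) → ℝ} (hf : Measurable f)
    (hf0 : ∀ x, 0 ≤ f x) (φ : EuclideanSpace ℝ (Fin d) → ℝ) :
    ∫ x, φ x ∂(densityMeasure f) = ∫ x, φ x * f x := by
  have : densityMeasure f = volume.withDensity (fun x => ((f x).toNNReal : ℝ≥0∞)) := rfl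
  rw [this, integral_withDensity_eq_integral_smul hf.real_toNNReal]
  refine integral_congr_ae (Eventually.of_forall fun x => ?_)
  simp [NNReal.smul_def, Real.coe_toNNReal _ (hf0 x), mul_comm]

lemma integrable_densityMeasure_iff {f : EuclideanSpace ℝ (Fin d) → ℝ} (hf : Measurable f)
    (hf0 : ∀ x, 0 ≤ f x) {φ : EuclideanSpace ℝ (Fin d) → ℝ} :
    Integrable φ (densityMeasure f) ↔ Integrable (fun x => φ x * f x) := by
  have : densityMeasure f = volume.withDensity (fun x => ((f x).toNNReal : ℝ≥0∞)) := rfl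
  rw [this, integrable_withDensity_iff_integrable_smul hf.real_toNNReal]
  refine integrable_congr (Eventually.of_forall fun x => ?_)
  simp [NNReal.smul_def, Real.coe_toNNReal _ (hf0 x), mul_comm]

lemma densityMeasure_univ {f : EuclideanSpace ℝ (Fin d) → ℝ} (hf : Integrable f)
    (hf0 : ∀ x, 0 ≤ f x) :
    densityMeasure f Set.univ = ENNReal.ofReal (∫ x, f x) := by
  rw [densityMeasure, withDensity_apply _ MeasurableSet.univ, Measure.restrict_univ,
    ofReal_integral_eq_lintegral_ofReal hf (Eventually.of_forall hf0)]

lemma ae_densityMeasure_iff {f : EuclideanSpace ℝ (Fin d) → ℝ} (hf : Measurable f)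
    (hf0 : ∀ x, 0 < f x) {q : EuclideanSpace ℝ (Fin d) → Prop} :
    (∀ᵐ x ∂(densityMeasure f), q x) ↔ ∀ᵐ x, q x := by
  rw [densityMeasure, ae_withDensity_iff hf.ennreal_ofReal]
  simp [hf0]

lemma densityMeasure_congr {f g : EuclideanSpace ℝ (Fin d) → ℝ} (h : f =ᵐ[volume] g) :
    densityMeasure f = densityMeasure g :=
  withDensity_congr_ae (h.mono fun x hx => by simp only [hx])

/-- Positive measurable densities of the same probability measure agree almost everywhere. -/
lemma ae_eq_of_densityMeasure_eq {f g : EuclideanSpace ℝ (Fin d) → ℝ} (hf : Measurable f)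
    (hg : Measurable g) (hf0 : ∀ x, 0 < f x) (hg0 : ∀ x, 0 < g x)
    (h1 : IsFiniteMeasure (densityMeasure f)) (h : densityMeasure f = densityMeasure g) :
    f =ᵐ[volume] g := by
  have hfin : ∫⁻ x, ENNReal.ofReal (f x) ≠ ∞ := by
    have := measure_ne_top (densityMeasure f) Set.univ
    rwa [densityMeasure, withDensity_apply _ MeasurableSet.univ, Measure.restrict_univ] at this
  have := (withDensity_eq_iff hf.ennreal_ofReal.aemeasurable hg.ennreal_ofReal.aemeasurable
    hfin).1 h
  exact this.mono fun x hx => (ENNReal.ofReal_eq_ofReal_iff (hf0 x).le (hg0 x).le).1 hx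

/-! ### Exponential tilting -/

/-- Two distinct positive probability densities whose log-ratio is square integrable with respect
to both of them. -/
structure IsTemperingPair (p₀ p : EuclideanSpace ℝ (Fin d) → ℝ) : Prop where
  measurable₀ : Measurable p₀
  measurable : Measurable p
  pos₀ : ∀ x, 0 < p₀ x
  pos : ∀ x, 0 < p x
  integrable₀ : Integrable p₀
  integrable : Integrable p
  integral₀ : ∫ x, p₀ x = 1
  integral : ∫ x, p x = 1
  integrable_sq₀ : Integrable fun x => logRatio p₀ p x ^ 2 * p₀ x
  integrable_sq : Integrable fun x => logRatio p₀ p x ^ 2 * p x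
  ne : densityMeasure p₀ ≠ densityMeasure p

/-- The unnormalised density of the geometric mixture, written as an exponential tilt. -/
def tilt (p₀ p : EuclideanSpace ℝ (Fin d) → ℝ) (b : ℝ) (x : EuclideanSpace ℝ (Fin d)) : ℝ :=
  p₀ x * Real.exp (b * logRatio p₀ p x)

/-- The moments of the log-ratio under the unnormalised geometric mixture. -/
def moment (p₀ p : EuclideanSpace ℝ (Fin d) → ℝ) (k : ℕ) (b : ℝ) : ℝ :=
  ∫ x, logRatio p₀ p x ^ k * tilt p₀ p b x

/-- The mean of the log-ratio under the geometric mixture. -/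
def tiltMean (p₀ p : EuclideanSpace ℝ (Fin d) → ℝ) (b : ℝ) : ℝ :=
  moment p₀ p 1 b / moment p₀ p 0 b

/-- The variance of the log-ratio under the geometric mixture. -/
def tiltVar (p₀ p : EuclideanSpace ℝ (Fin d) → ℝ) (b : ℝ) : ℝ :=
  moment p₀ p 2 b / moment p₀ p 0 b - tiltMean p₀ p b ^ 2

namespace IsTemperingPair

variable {p₀ p : EuclideanSpace ℝ (Fin d) → ℝ} (H : IsTemperingPair p₀ p)

include H

lemma exp_logRatio (x : EuclideanSpace ℝ (Fin d)) : Real.exp (logRatio p₀ p x) = p x / p₀ x :=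
  Real.exp_log (div_pos (H.pos x) (H.pos₀ x))

lemma tilt_eq (b : ℝ) (x : EuclideanSpace ℝ (Fin d)) :
    p₀ x ^ (1 - b) * p x ^ b = tilt p₀ p b x := by
  have h0 := H.pos₀ x
  rw [tilt, mul_comm b, Real.exp_mul, H.exp_logRatio, Real.div_rpow (H.pos x).le h0.le,
    Real.rpow_sub h0, Real.rpow_one]
  ring

lemma tilt_one (x : EuclideanSpace ℝ (Fin d)) : tilt p₀ p 1 x = p x := by
  rw [← H.tilt_eq]; simp

lemma tilt_pos (b : ℝ) (x : EuclideanSpace ℝ (Fin d)) : 0 < tilt p₀ p b x :=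
  mul_pos (H.pos₀ x) (Real.exp_pos _)

lemma measurable_logRatio : Measurable (logRatio p₀ p) :=
  (H.measurable.div H.measurable₀).log

lemma measurable_tilt (b : ℝ) : Measurable (tilt p₀ p b) :=
  H.measurable₀.mul (H.measurable_logRatio.const_mul b).exp

/-- For `b ∈ [0,1]`, `e^{bg}` lies below 1 where `g ≤ 0` and below `e^g` where `g ≥ 0`. -/
lemma tilt_le {b : ℝ} (hb : b ∈ Set.Icc (0 : ℝ) 1) (x : EuclideanSpace ℝ (Fin d)) :
    tilt p₀ p b x ≤ p₀ x + p x := by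
  have h0 := H.pos₀ x
  have h1 := H.pos x
  rcases le_total (logRatio p₀ p x) 0 with h | h
  · have : Real.exp (b * logRatio p₀ p x) ≤ 1 :=
      Real.exp_le_one_iff.2 (mul_nonpos_of_nonneg_of_nonpos hb.1 h)
    have := mul_le_mul_of_nonneg_left this h0.le
    rw [tilt]
    linarith
  · have : tilt p₀ p b x ≤ tilt p₀ p 1 x := by
      rw [tilt, tilt]
      gcongr
      exact hb.2
    rw [H.tilt_one] at this
    linarith

/-- A majorant independent of `b`, used in every dominated convergence argument below; this is where
square integrability under both densities enters. -/
lemma integrable_envelope :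
    Integrable fun x => (1 + logRatio p₀ p x ^ 2) * (p₀ x + p x) := by
  refine ((H.integrable₀.add H.integrable).add (H.integrable_sq₀.add H.integrable_sq)).congr
    (Eventually.of_forall fun x => ?_)
  simp only [Pi.add_apply]
  ring

lemma norm_mul_tilt_le {b : ℝ} (hb : b ∈ Set.Icc (0 : ℝ) 1)
    {φ : EuclideanSpace ℝ (Fin d) → ℝ} {C : ℝ}
    (hC : ∀ x, |φ x| ≤ C * (1 + logRatio p₀ p x ^ 2)) (x : EuclideanSpace ℝ (Fin d)) :
    ‖φ x * tilt p₀ p b x‖ ≤ C * ((1 + logRatio p₀ p x ^ 2) * (p₀ x + p x)) := by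
  rw [norm_mul, Real.norm_eq_abs, Real.norm_of_nonneg (H.tilt_pos b x).le, ← mul_assoc]
  exact mul_le_mul (hC x) (H.tilt_le hb x) (H.tilt_pos b x).le ((abs_nonneg _).trans (hC x))

lemma integrable_mul_tilt {b : ℝ} (hb : b ∈ Set.Icc (0 : ℝ) 1)
    {φ : EuclideanSpace ℝ (Fin d) → ℝ} (hφ : Measurable φ) {C : ℝ}
    (hC : ∀ x, |φ x| ≤ C * (1 + logRatio p₀ p x ^ 2)) :
    Integrable fun x => φ x * tilt p₀ p b x :=
  (H.integrable_envelope.const_mul C).mono' (hφ.mul (H.measurable_tilt b)).aestronglyMeasurable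
    (Eventually.of_forall (H.norm_mul_tilt_le hb hC))

lemma continuousOn_integral_mul_tilt {φ : EuclideanSpace ℝ (Fin d) → ℝ} (hφ : Measurable φ)
    {C : ℝ} (hC : ∀ x, |φ x| ≤ C * (1 + logRatio p₀ p x ^ 2)) :
    ContinuousOn (fun b => ∫ x, φ x * tilt p₀ p b x) (Set.Icc 0 1) := by
  refine continuousOn_of_dominated
    (fun b _ => (hφ.mul (H.measurable_tilt b)).aestronglyMeasurable)
    (fun b hb => Eventually.of_forall (H.norm_mul_tilt_le hb hC))
    (H.integrable_envelope.const_mul C) (Eventually.of_forall fun x => ?_)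
  unfold tilt
  fun_prop

omit H in
lemma abs_logRatio_pow_le {k : ℕ} (hk : k ≤ 2) (x : EuclideanSpace ℝ (Fin d)) :
    |logRatio p₀ p x ^ k| ≤ 1 * (1 + logRatio p₀ p x ^ 2) := by
  set g := logRatio p₀ p x
  rw [one_mul, abs_pow, ← sq_abs g]
  have := abs_nonneg g
  interval_cases k <;> nlinarith [sq_nonneg (|g| - 1)]

lemma integrable_moment {k : ℕ} (hk : k ≤ 2) {b : ℝ} (hb : b ∈ Set.Icc (0 : ℝ) 1) :
    Integrable fun x => logRatio p₀ p x ^ k * tilt p₀ p b x :=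
  H.integrable_mul_tilt hb (H.measurable_logRatio.pow_const k) (abs_logRatio_pow_le hk)

lemma continuousOn_moment {k : ℕ} (hk : k ≤ 2) :
    ContinuousOn (moment p₀ p k) (Set.Icc 0 1) :=
  H.continuousOn_integral_mul_tilt (H.measurable_logRatio.pow_const k) (abs_logRatio_pow_le hk)

omit H in
lemma hasDerivAt_pow_mul_tilt (k : ℕ) (x : EuclideanSpace ℝ (Fin d)) (b : ℝ) :
    HasDerivAt (fun c => logRatio p₀ p x ^ k * tilt p₀ p c x)
      (logRatio p₀ p x ^ (k + 1) * tilt p₀ p b x) b := by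
  have h := ((((hasDerivAt_id b).mul_const (logRatio p₀ p x)).exp).const_mul
    (p₀ x)).const_mul (logRatio p₀ p x ^ k)
  refine h.congr_deriv ?_
  simp only [tilt, id]
  ring

/-- Differentiation under the integral: the mean value inequality bounds the difference quotients by
the envelope for the power `k + 1`, whence `k ≤ 1`. The derivative is taken within `[0,1]`, since
the tilts are dominated only there. -/
lemma hasDerivWithinAt_moment {k : ℕ} (hk : k ≤ 1) {b : ℝ} (hb : b ∈ Set.Icc (0 : ℝ) 1) :
    HasDerivWithinAt (moment p₀ p k) (moment p₀ p (k + 1) b) (Set.Icc 0 1) b := by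
  rw [hasDerivWithinAt_iff_tendsto_slope]
  have hslope : ∀ c ∈ Set.Icc (0 : ℝ) 1 \ {b},
      ∫ x, slope (fun c => logRatio p₀ p x ^ k * tilt p₀ p c x) b c =
        slope (moment p₀ p k) b c := by
    intro c hc
    simp only [slope_def_field, moment]
    rw [integral_div, integral_sub (H.integrable_moment (by omega) hc.1)
      (H.integrable_moment (by omega) hb)]
  refine Tendsto.congr' (eventually_nhdsWithin_of_forall hslope) ?_
  refine tendsto_integral_filter_of_dominated_convergence
    (fun x => 1 * ((1 + logRatio p₀ p x ^ 2) * (p₀ x + p x))) ?_ ?_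
    (H.integrable_envelope.const_mul 1) ?_
  · refine Eventually.of_forall fun c => Measurable.aestronglyMeasurable ?_
    simp only [slope_def_field]
    exact (((H.measurable_logRatio.pow_const k).mul (H.measurable_tilt c)).sub
      ((H.measurable_logRatio.pow_const k).mul (H.measurable_tilt b))).div_const _
  · refine eventually_nhdsWithin_of_forall fun c hc => Eventually.of_forall fun x => ?_
    have hcb : 0 < ‖c - b‖ := norm_pos_iff.2 (sub_ne_zero.2 hc.2)
    have := (convex_Icc (0 : ℝ) 1).norm_image_sub_le_of_norm_hasDerivWithin_le
      (fun y _ => (hasDerivAt_pow_mul_tilt (p₀ := p₀) (p := p) k x y).hasDerivWithinAt)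
      (fun y hy => H.norm_mul_tilt_le hy (abs_logRatio_pow_le (k := k + 1) (by omega)) x)
      hb hc.1
    rw [slope_def_field, norm_div, div_le_iff₀ hcb]
    exact this
  · refine Eventually.of_forall fun x => ?_
    exact hasDerivWithinAt_iff_tendsto_slope.1
      (hasDerivAt_pow_mul_tilt (p₀ := p₀) (p := p) k x b).hasDerivWithinAt

lemma moment_zero_pos {b : ℝ} (hb : b ∈ Set.Icc (0 : ℝ) 1) : 0 < moment p₀ p 0 b := by
  have hpos : ∀ x, 0 < logRatio p₀ p x ^ 0 * tilt p₀ p b x := fun x => by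
    simpa using H.tilt_pos b x
  rw [moment, integral_pos_iff_support_of_nonneg (fun x => (hpos x).le)
    (H.integrable_moment (by omega) hb), Function.support_eq_univ fun x => (hpos x).ne',
    Measure.measure_univ_pos]
  exact NeZero.ne _

/-! ### Geometric mixtures as an exponential family -/

lemma temperedDensity_eq (b : ℝ) (x : EuclideanSpace ℝ (Fin d)) :
    temperedDensity p₀ p b x = tilt p₀ p b x / moment p₀ p 0 b := by
  simp only [temperedDensity, moment, H.tilt_eq, pow_zero, one_mul]

lemma temperedDensity_pos {b : ℝ} (hb : b ∈ Set.Icc (0 : ℝ) 1) (x : EuclideanSpace ℝ (Fin d)) :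
    0 < temperedDensity p₀ p b x := by
  rw [H.temperedDensity_eq]
  exact div_pos (H.tilt_pos b x) (H.moment_zero_pos hb)

lemma log_temperedDensity {b : ℝ} (hb : b ∈ Set.Icc (0 : ℝ) 1)
    (x : EuclideanSpace ℝ (Fin d)) : Real.log (temperedDensity p₀ p b x) =
      Real.log (p₀ x) + b * logRatio p₀ p x - Real.log (moment p₀ p 0 b) := by
  rw [H.temperedDensity_eq, Real.log_div (H.tilt_pos b x).ne' (H.moment_zero_pos hb).ne', tilt,
    Real.log_mul (H.pos₀ x).ne' (Real.exp_pos _).ne', Real.log_exp]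

lemma measurable_temperedDensity (b : ℝ) : Measurable (temperedDensity p₀ p b) := by
  rw [funext (H.temperedDensity_eq b)]
  exact (H.measurable_tilt b).div_const _

lemma temperedDensity_zero : temperedDensity p₀ p 0 = p₀ := by
  funext x
  simp [temperedDensity, H.integral₀]

lemma temperedDensity_one : temperedDensity p₀ p 1 = p := by
  funext x
  simp [temperedDensity, H.integral]

lemma integral_temperedMeasure {b : ℝ} (hb : b ∈ Set.Icc (0 : ℝ) 1)
    (φ : EuclideanSpace ℝ (Fin d) → ℝ) :
    ∫ x, φ x ∂(temperedMeasure p₀ p b) = (∫ x, φ x * tilt p₀ p b x) / moment p₀ p 0 b := by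
  rw [temperedMeasure, integral_densityMeasure (H.measurable_temperedDensity b)
    fun x => (H.temperedDensity_pos hb x).le, ← integral_div]
  simp only [H.temperedDensity_eq, mul_div_assoc]

lemma integrable_temperedMeasure {b : ℝ} (hb : b ∈ Set.Icc (0 : ℝ) 1)
    {φ : EuclideanSpace ℝ (Fin d) → ℝ} (hφ : Measurable φ) {C : ℝ}
    (hC : ∀ x, |φ x| ≤ C * (1 + logRatio p₀ p x ^ 2)) :
    Integrable φ (temperedMeasure p₀ p b) := by
  rw [temperedMeasure, integrable_densityMeasure_iff (H.measurable_temperedDensity b)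
    fun x => (H.temperedDensity_pos hb x).le]
  simp only [H.temperedDensity_eq, ← mul_div_assoc]
  exact (H.integrable_mul_tilt hb hφ hC).div_const _

lemma integrable_logRatio {b : ℝ} (hb : b ∈ Set.Icc (0 : ℝ) 1) :
    Integrable (logRatio p₀ p) (temperedMeasure p₀ p b) :=
  H.integrable_temperedMeasure hb H.measurable_logRatio (C := 1) fun x => by
    simpa using abs_logRatio_pow_le (p₀ := p₀) (p := p) (k := 1) (by omega) x

lemma integral_logRatio {b : ℝ} (hb : b ∈ Set.Icc (0 : ℝ) 1) :
    ∫ x, logRatio p₀ p x ∂(temperedMeasure p₀ p b) = tiltMean p₀ p b := by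
  rw [H.integral_temperedMeasure hb, tiltMean]
  simp only [moment, pow_one]

lemma isProbabilityMeasure_temperedMeasure {b : ℝ} (hb : b ∈ Set.Icc (0 : ℝ) 1) :
    IsProbabilityMeasure (temperedMeasure p₀ p b) := by
  have hint : Integrable (temperedDensity p₀ p b) := by
    rw [funext (H.temperedDensity_eq b)]
    simpa using (H.integrable_moment (k := 0) (by omega) hb).div_const (moment p₀ p 0 b)
  refine ⟨?_⟩
  rw [temperedMeasure, densityMeasure_univ hint fun x => (H.temperedDensity_pos hb x).le]
  have h0 : ∫ x, tilt p₀ p b x = moment p₀ p 0 b := by simp [moment]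
  simp only [H.temperedDensity_eq]
  rw [integral_div, h0, div_self (H.moment_zero_pos hb).ne', ENNReal.ofReal_one]

lemma memLp_logRatio {b : ℝ} (hb : b ∈ Set.Icc (0 : ℝ) 1) :
    MemLp (logRatio p₀ p) 2 (temperedMeasure p₀ p b) :=
  (memLp_two_iff_integrable_sq H.measurable_logRatio.aestronglyMeasurable).2
    (H.integrable_temperedMeasure hb (H.measurable_logRatio.pow_const 2)
      (abs_logRatio_pow_le le_rfl))

lemma variance_logRatio {b : ℝ} (hb : b ∈ Set.Icc (0 : ℝ) 1) :
    variance (logRatio p₀ p) (temperedMeasure p₀ p b) = tiltVar p₀ p b := by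
  have := H.isProbabilityMeasure_temperedMeasure hb
  rw [variance_eq_sub (H.memLp_logRatio hb), H.integral_logRatio hb, tiltVar]
  congr 1
  exact H.integral_temperedMeasure hb _

lemma variance_log_div {b : ℝ} (hb : b ∈ Set.Icc (0 : ℝ) 1) :
    variance (fun y => Real.log (p₀ y / p y)) (temperedMeasure p₀ p b) = tiltVar p₀ p b := by
  rw [← H.variance_logRatio hb, ← variance_neg]
  congr 1
  funext y
  rw [Pi.neg_apply, logRatio, ← Real.log_inv, inv_div]

/-- Zero variance would make `g` almost everywhere a constant `c`, so `p = e^c p₀`; equal masses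
force `e^c = 1`, contradicting distinctness. -/
lemma tiltVar_pos {b : ℝ} (hb : b ∈ Set.Icc (0 : ℝ) 1) : 0 < tiltVar p₀ p b := by
  have := H.isProbabilityMeasure_temperedMeasure hb
  rw [← H.variance_logRatio hb]
  refine (variance_nonneg _ _).lt_of_ne fun h => H.ne ?_
  have hae := ae_eq_integral_of_variance_eq_zero (H.memLp_logRatio hb) h.symm
  set c := ∫ x, logRatio p₀ p x ∂(temperedMeasure p₀ p b)
  have hae' : ∀ᵐ x, logRatio p₀ p x = c :=
    (ae_densityMeasure_iff (H.measurable_temperedDensity b) (H.temperedDensity_pos hb)).1 hae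
  have hp : p =ᵐ[volume] fun x => Real.exp c * p₀ x := by
    filter_upwards [hae'] with x hx
    rw [← hx, H.exp_logRatio, div_mul_cancel₀ _ (H.pos₀ x).ne']
  have hc : Real.exp c = 1 := by
    have := integral_congr_ae hp
    rw [integral_const_mul, H.integral, H.integral₀] at this
    linarith
  rw [hc] at hp
  simp only [one_mul] at hp
  exact densityMeasure_congr hp.symm

lemma hasDerivWithinAt_log_moment {b : ℝ} (hb : b ∈ Set.Icc (0 : ℝ) 1) :
    HasDerivWithinAt (fun b => Real.log (moment p₀ p 0 b)) (tiltMean p₀ p b) (Set.Icc 0 1) b :=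
  (H.hasDerivWithinAt_moment (k := 0) (by omega) hb).log (H.moment_zero_pos hb).ne'

lemma hasDerivWithinAt_tiltMean {b : ℝ} (hb : b ∈ Set.Icc (0 : ℝ) 1) :
    HasDerivWithinAt (tiltMean p₀ p) (tiltVar p₀ p b) (Set.Icc 0 1) b := by
  have h0 := (H.moment_zero_pos hb).ne'
  refine ((H.hasDerivWithinAt_moment (k := 1) le_rfl hb).div
    (H.hasDerivWithinAt_moment (k := 0) (by omega) hb) h0).congr_deriv ?_
  simp only [tiltVar, tiltMean, zero_add, Nat.reduceAdd]
  field_simp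

lemma continuousOn_tiltMean : ContinuousOn (tiltMean p₀ p) (Set.Icc 0 1) :=
  fun _ hb => (H.hasDerivWithinAt_tiltMean hb).continuousWithinAt

lemma continuousOn_tiltVar : ContinuousOn (tiltVar p₀ p) (Set.Icc 0 1) :=
  ((H.continuousOn_moment le_rfl).div (H.continuousOn_moment (by omega))
    fun _ hb => (H.moment_zero_pos hb).ne').sub (H.continuousOn_tiltMean.pow 2)

omit H in
/-- The geometric mixture as a probability measure. -/
def mixture (H : IsTemperingPair p₀ p) (b : I) : ProbabilityMeasure (EuclideanSpace ℝ (Fin d)) :=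
  ⟨temperedMeasure p₀ p b, H.isProbabilityMeasure_temperedMeasure b.2⟩

lemma continuous_mixture : Continuous H.mixture := by
  rw [continuous_iff_continuousAt]
  intro b
  refine ProbabilityMeasure.tendsto_iff_forall_integral_tendsto.2 fun f => ?_
  have hf : ContinuousOn (fun b => ∫ x, f x * tilt p₀ p b x) (Set.Icc 0 1) := by
    refine H.continuousOn_integral_mul_tilt f.continuous.measurable (C := ‖f‖) fun x => ?_
    have := f.norm_coe_le_norm x
    rw [Real.norm_eq_abs] at this
    nlinarith [norm_nonneg f, mul_nonneg (norm_nonneg f) (sq_nonneg (logRatio p₀ p x))]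
  have hq := (hf.div (H.continuousOn_moment (k := 0) (by omega))
    fun _ hb => (H.moment_zero_pos hb).ne').domRestrict
  refine ((hq.tendsto b).congr fun c => ?_).trans_eq ?_
  · exact (H.integral_temperedMeasure c.2 _).symm
  · congr 1
    exact (H.integral_temperedMeasure b.2 _).symm

end IsTemperingPair

/-! ### The flow in the coordinates `(b, l)` -/

/-- The flow in the coordinates `(b, l)` of the state `(π_b, l)`, where `m` and `v` are the mean
and the variance of the log-ratio. -/
structure IsReducedFlow (m v b l : ℝ → ℝ) : Prop where
  mem_b : ∀ t, 0 ≤ t → b t ∈ Set.Icc (0 : ℝ) 1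
  mem_l : ∀ t, 0 ≤ t → l t ∈ Set.Icc (0 : ℝ) 1
  deriv_b : ∀ t, 0 ≤ t → HasDerivWithinAt b (l t - b t) (Set.Ici 0) t
  deriv_l : ∀ t, 0 ≤ t →
    HasDerivWithinAt l (m (b t) - m (l t) + (1 - l t) * v (l t)) (Set.Ici 0) t

section

variable {m v : ℝ → ℝ}
  (hm : ∀ b ∈ Set.Icc (0 : ℝ) 1, HasDerivWithinAt m (v b) (Set.Icc 0 1) b)
  (hv : ContinuousOn v (Set.Icc 0 1)) (hpos : ∀ b ∈ Set.Icc (0 : ℝ) 1, 0 < v b)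

include hm hpos

lemma strictMonoOn_of_reduced : StrictMonoOn m (Set.Icc 0 1) :=
  strictMonoOn_of_hasDerivWithinAt_pos (convex_Icc 0 1)
    (fun b hb => (hm b hb).continuousWithinAt)
    (fun b hb => (hm b (interior_subset hb)).mono interior_subset)
    fun b hb => hpos b (interior_subset hb)

include hv

/-- The reduced flow converges exponentially fast to `(1, 1)`, uniformly in the initial value. -/
theorem exists_exponential_decay : ∃ a κ : ℝ, 1 ≤ a ∧ 0 < κ ∧
    ∀ b l : ℝ → ℝ, IsReducedFlow m v b l → ∀ t, 0 ≤ t →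
      max (1 - b t) (a * (1 - l t)) ≤ Real.exp (-(κ * t)) * max (1 - b 0) (a * (1 - l 0)) := by
  have hne : (Set.Icc (0 : ℝ) 1).Nonempty := Set.nonempty_Icc.2 zero_le_one
  obtain ⟨β, hβ, hmin⟩ := isCompact_Icc.exists_isMinOn hne hv
  obtain ⟨β', hβ', hmax⟩ := isCompact_Icc.exists_isMaxOn hne hv
  set c := v β with hcdef
  set C := v β' with hCdef
  have hc : 0 < c := hpos β hβ
  have hC : 0 < C := hpos β' hβ'
  have hmin' : ∀ x ∈ Set.Icc (0 : ℝ) 1, c ≤ v x := fun x hx => hmin hx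
  have hmono := (strictMonoOn_of_reduced hm hpos).monotoneOn
  have hlip : ∀ x ∈ Set.Icc (0 : ℝ) 1, ∀ y ∈ Set.Icc (0 : ℝ) 1, x ≤ y →
      m y - m x ≤ C * (y - x) := by
    intro x hx y hy hxy
    have := (convex_Icc (0 : ℝ) 1).norm_image_sub_le_of_norm_hasDerivWithin_le hm
      (C := C) (fun z hz => by
        rw [Real.norm_of_nonneg (hpos z hz).le]; exact hmax hz) hx hy
    rw [Real.norm_eq_abs, Real.norm_of_nonneg (sub_nonneg.2 hxy)] at this
    exact (le_abs_self _).trans this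
  -- Chosen so that `C (a - 1) = c / 2`: the Lipschitz error then uses up only half of the damping
  -- `c`.
  set a := 1 + c / (2 * C) with ha
  have ha1 : 1 < a := by rw [ha]; linarith [show 0 < c / (2 * C) by positivity]
  have ha0 : 0 < a := by linarith
  have haC : C * (a - 1) = c / 2 := by rw [ha]; field_simp; ring
  -- The two entries are the decay rates in the regions where `1 - b`, respectively `a (1 - l)`, is
  -- the larger.
  set κ := min (1 - 1 / a) (c / 2) with hκ
  have hκ1 : κ ≤ 1 - 1 / a := min_le_left _ _
  have hκ2 : κ ≤ c / 2 := min_le_right _ _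
  have hκ0 : 0 < κ := lt_min (by rw [sub_pos, div_lt_one ha0]; exact ha1) (by positivity)
  refine ⟨a, κ, ha1.le, hκ0, fun b l hbl t ht => ?_⟩
  have hexp : ∀ t, HasDerivWithinAt (fun t => Real.exp (κ * t)) (Real.exp (κ * t) * κ)
      (Set.Ici 0) t := fun t => by
    simpa using (((hasDerivAt_id t).const_mul κ).exp).hasDerivWithinAt
  have key := max_le_of_deriv_nonpos (P := fun t => Real.exp (κ * t) * (1 - b t))
    (Q := fun t => Real.exp (κ * t) * (a * (1 - l t)))
    (fun t ht => (hexp t).mul ((hbl.deriv_b t ht).const_sub 1))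
    (fun t ht => (hexp t).mul (((hbl.deriv_l t ht).const_sub 1).const_mul a)) ?_ ?_ ht
  · simp only [mul_zero, Real.exp_zero, one_mul] at key
    rw [← mul_max_of_nonneg _ _ (Real.exp_pos _).le] at key
    rw [Real.exp_neg, inv_mul_eq_div, le_div_iff₀ (Real.exp_pos _), mul_comm]
    exact key
  · intro t ht h
    have hb := hbl.mem_b t ht
    have h1 := le_of_mul_le_mul_left h (Real.exp_pos _)
    have h2 : 1 - l t ≤ 1 / a * (1 - b t) := by
      rw [one_div, inv_mul_eq_div, le_div_iff₀ ha0]; linarith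
    have h3 := mul_le_mul_of_nonneg_right hκ1 (sub_nonneg.2 hb.2)
    have : κ * (1 - b t) + -(l t - b t) ≤ 0 := by linarith
    have := mul_nonpos_of_nonneg_of_nonpos (Real.exp_pos (κ * t)).le this
    linarith
  · intro t ht h
    have hb := hbl.mem_b t ht
    have hl := hbl.mem_l t ht
    have hy := sub_nonneg.2 hl.2
    have h1 := le_of_mul_le_mul_left h (Real.exp_pos _)
    -- Here `1 - b ≤ a (1 - l)`, that is, `l - b ≤ (a - 1)(1 - l)`. If `b ≥ l`, monotonicity of `m`
    -- already gives the favourable sign.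
    have h2 : -(c / 2 * (1 - l t)) ≤ m (b t) - m (l t) := by
      rw [← haC]
      rcases le_total (b t) (l t) with hle | hle
      · have := hlip _ hb _ hl hle
        have : C * (l t - b t) ≤ C * ((a - 1) * (1 - l t)) :=
          mul_le_mul_of_nonneg_left (by linarith) hC.le
        linarith
      · have := hmono hl hb hle
        have : 0 ≤ C * (a - 1) * (1 - l t) := by rw [haC]; positivity
        linarith
    have h3 := mul_le_mul_of_nonneg_left (hmin' _ hl) hy
    have h4 := mul_le_mul_of_nonneg_right hκ2 hy
    have : κ * (1 - l t) + -(m (b t) - m (l t) + (1 - l t) * v (l t)) ≤ 0 := by linarith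
    have := mul_nonpos_of_nonneg_of_nonpos
      (mul_nonneg (Real.exp_pos (κ * t)).le ha0.le) this
    linarith

/-- The reduced flow exists globally from every initial value. -/
theorem exists_reducedFlow {b₀ l₀ : ℝ} (hb₀ : b₀ ∈ Set.Icc (0 : ℝ) 1)
    (hl₀ : l₀ ∈ Set.Icc (0 : ℝ) 1) :
    ∃ b l : ℝ → ℝ, IsReducedFlow m v b l ∧ b 0 = b₀ ∧ l 0 = l₀ := by
  have hmono := (strictMonoOn_of_reduced hm hpos).monotoneOn
  have hmc : ContinuousOn m (Set.Icc 0 1) := fun b hb => (hm b hb).continuousWithinAt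
  have hmI : Continuous fun x : I => m x := hmc.domRestrict
  have hvI : Continuous fun x : I => v x := hv.domRestrict
  let G : I × I → ℝ × ℝ := fun z =>
    ((z.2 : ℝ) - z.1, m z.1 - m z.2 + (1 - (z.2 : ℝ)) * v z.2)
  have hG : Continuous G := by
    have h1 := hmI.comp (continuous_fst (X := I) (Y := I))
    have h2 := hmI.comp (continuous_snd (X := I) (Y := I))
    have h3 := hvI.comp (continuous_snd (X := I) (Y := I))
    simp only [Function.comp_def] at h1 h2 h3
    exact (by fun_prop : Continuous fun z : I × I => (z.2 : ℝ) - z.1).prodMk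
      ((h1.sub h2).add ((by fun_prop : Continuous fun z : I × I => 1 - (z.2 : ℝ)).mul h3))
  let q : ℝ → I := Set.projIcc 0 1 zero_le_one
  have hq : UniformContinuous q := (LipschitzWith.projIcc zero_le_one).uniformContinuous
  -- Composing with the projection onto the square gives a bounded, uniformly continuous field on
  -- the whole plane. Its solutions starting in the square stay there, because at or beyond each
  -- side it does not point outwards.
  let F : ℝ × ℝ → ℝ × ℝ := fun z => G (q z.1, q z.2)
  have hF : UniformContinuous F :=
    (CompactSpace.uniformContinuous_of_continuous hG).comp
      ((hq.comp uniformContinuous_fst).prodMk (hq.comp uniformContinuous_snd))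
  obtain ⟨K, hK⟩ := (isCompact_range hG).isBounded.exists_norm_le
  obtain ⟨x, hx0, hx⟩ := exists_forward_solution hF (fun z => hK _ ⟨_, rfl⟩) (b₀, l₀)
  have hd1 : ∀ t, 0 ≤ t → HasDerivWithinAt (fun s => (x s).1)
      ((q (x t).2 : ℝ) - q (x t).1) (Set.Ici 0) t := fun t ht => by
    simpa using (hx t ht).hasFDerivWithinAt.fst.hasDerivWithinAt
  have hd2 : ∀ t, 0 ≤ t → HasDerivWithinAt (fun s => (x s).2)
      (m (q (x t).1) - m (q (x t).2) + (1 - (q (x t).2 : ℝ)) * v (q (x t).2))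
      (Set.Ici 0) t := fun t ht => by
    simpa using (hx t ht).hasFDerivWithinAt.snd.hasDerivWithinAt
  have hq1 : ∀ {s : ℝ}, 1 ≤ s → q s = 1 := fun h => Set.projIcc_of_right_le _ h
  have hq0 : ∀ {s : ℝ}, s ≤ 0 → q s = 0 := fun h => Set.projIcc_of_le_left _ h
  have hb : ∀ t, 0 ≤ t → (x t).1 ∈ Set.Icc (0 : ℝ) 1 := fun t ht =>
    ⟨ge_of_deriv_nonneg hd1 (fun t _ h => by simpa [hq0 h] using (q (x t).2).2.1)
      (by simpa [hx0] using hb₀.1) ht,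
      le_of_deriv_nonpos hd1 (fun t _ h => by simpa [hq1 h] using (q (x t).2).2.2)
      (by simpa [hx0] using hb₀.2) ht⟩
  have hl : ∀ t, 0 ≤ t → (x t).2 ∈ Set.Icc (0 : ℝ) 1 := fun t ht =>
    ⟨ge_of_deriv_nonneg hd2 (fun t _ h => by
        have h1 := hmono (Set.left_mem_Icc.2 zero_le_one) (q (x t).1).2 (q (x t).1).2.1
        have h2 := hpos 0 (Set.left_mem_Icc.2 zero_le_one)
        simp only [hq0 h, Set.Icc.coe_zero]
        linarith) (by simpa [hx0] using hl₀.1) ht,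
      le_of_deriv_nonpos hd2 (fun t _ h => by
        have h1 := hmono (q (x t).1).2 (Set.right_mem_Icc.2 zero_le_one) (q (x t).1).2.2
        simp only [hq1 h, Set.Icc.coe_one]
        linarith) (by simpa [hx0] using hl₀.2) ht⟩
  have hqi : ∀ {s : ℝ}, s ∈ Set.Icc (0 : ℝ) 1 → (q s : ℝ) = s := fun h => by
    simp only [q, Set.projIcc_of_mem zero_le_one h]
  refine ⟨fun t => (x t).1, fun t => (x t).2, ⟨hb, hl, fun t ht => ?_, fun t ht => ?_⟩, ?_, ?_⟩
  · simpa only [hqi (hb t ht), hqi (hl t ht)] using hd1 t ht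
  · simpa only [hqi (hb t ht), hqi (hl t ht)] using hd2 t ht
  · simp [hx0]
  · simp [hx0]

end

/-- The relaxation equation `b' = l - b` driven by a continuous `l : [0,∞) → [0,1]` has a
solution with values in `[0,1]`. -/
theorem exists_relaxation {l : ℝ → ℝ} (hl : ContinuousOn l (Set.Ici 0))
    (hl01 : ∀ t, 0 ≤ t → l t ∈ Set.Icc (0 : ℝ) 1) {b₀ : ℝ} (hb₀ : b₀ ∈ Set.Icc (0 : ℝ) 1) :
    ∃ b : ℝ → ℝ, b 0 = b₀ ∧ (∀ t, 0 ≤ t → b t ∈ Set.Icc (0 : ℝ) 1) ∧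
      ∀ t, 0 ≤ t → HasDerivWithinAt b (l t - b t) (Set.Ici 0) t := by
  -- Freezing `l` at `l 0` for negative times gives a continuous function on `ℝ`, for which
  -- variation of constants solves the equation.
  have hL : Continuous fun s => l (max s 0) := by
    refine continuous_iff_continuousAt.2 fun s => ?_
    exact ((hl _ (le_max_right s 0)).tendsto.comp
      (tendsto_nhdsWithin_iff.2 ⟨((continuous_id.max continuous_const).tendsto s),
        Eventually.of_forall fun r => le_max_right r 0⟩))
  have hL' : Continuous fun s => Real.exp s * l (max s 0) := Real.continuous_exp.mul hL
  let b : ℝ → ℝ := fun t => Real.exp (-t) * (b₀ + ∫ s in (0 : ℝ)..t, Real.exp s * l (max s 0))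
  have hb : ∀ t, 0 ≤ t → HasDerivWithinAt b (l t - b t) (Set.Ici 0) t := by
    intro t ht
    have h1 := (hL'.integral_hasStrictDerivAt 0 t).hasDerivAt
    have h2 := ((hasDerivAt_id t).neg.exp).mul (h1.const_add b₀)
    refine (h2.congr_deriv ?_).hasDerivWithinAt
    have : Real.exp (-t) * Real.exp t = 1 := by rw [← Real.exp_add]; simp
    simp only [b, max_eq_left ht, Pi.neg_apply, id]
    linear_combination l t * this
  have h0 : b 0 = b₀ := by simp [b]
  refine ⟨b, h0, fun t ht => ⟨?_, ?_⟩, hb⟩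
  · exact ge_of_deriv_nonneg hb (fun s hs h => by linarith [(hl01 s hs).1]) (h0 ▸ hb₀.1) ht
  · exact le_of_deriv_nonpos hb (fun s hs h => by linarith [(hl01 s hs).2]) (h0 ▸ hb₀.2) ht

/-- Solutions of `y' = -y` with zero initial value vanish. -/
theorem eq_zero_of_deriv_eq_neg {y : ℝ → ℝ}
    (hy : ∀ t, 0 ≤ t → HasDerivWithinAt y (-y t) (Set.Ici 0) t) (h0 : y 0 = 0) {t : ℝ}
    (ht : 0 ≤ t) : y t = 0 :=
  le_antisymm
    (le_of_deriv_nonpos hy (fun _ _ h => neg_nonpos.2 h) h0.le ht)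
    (ge_of_deriv_nonneg hy (fun _ _ h => neg_nonneg.2 h) h0.ge ht)

namespace IsTemperingPair

variable {p₀ p : EuclideanSpace ℝ (Fin d) → ℝ} (H : IsTemperingPair p₀ p)

include H

/-! ### The flow preserves the geometric mixtures -/

lemma log_div_temperedDensity {r : ℝ} (hr : 0 < r) {l : ℝ} (hl : l ∈ Set.Icc (0 : ℝ) 1)
    (x : EuclideanSpace ℝ (Fin d)) : Real.log (r / temperedDensity p₀ p l x) =
      Real.log r - Real.log (p₀ x) - l * logRatio p₀ p x + Real.log (moment p₀ p 0 l) := by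
  rw [Real.log_div hr.ne' (H.temperedDensity_pos hl x).ne', H.log_temperedDensity hl]
  ring

/-- A probability measure whose log-density is, almost everywhere and up to a constant, that of
the tilt by `b` is the geometric mixture. -/
lemma densityMeasure_eq_temperedMeasure {f : EuclideanSpace ℝ (Fin d) → ℝ} (hf0 : ∀ x, 0 < f x)
    {b : ℝ} (hb : b ∈ Set.Icc (0 : ℝ) 1) {A : ℝ}
    (hA : ∀ᵐ x, Real.log (f x) = A + Real.log (p₀ x) + b * logRatio p₀ p x)
    (h1 : IsProbabilityMeasure (densityMeasure f)) :
    densityMeasure f = temperedMeasure p₀ p b := by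
  have hf : f =ᵐ[volume] fun x => Real.exp A * tilt p₀ p b x := by
    filter_upwards [hA] with x hx
    rw [← Real.exp_log (hf0 x), hx, Real.exp_add, Real.exp_add, Real.exp_log (H.pos₀ x), tilt,
      mul_assoc]
  have hint : Integrable (tilt p₀ p b) := by
    simpa using H.integrable_moment (k := 0) (by omega) hb
  have hA1 : Real.exp A * moment p₀ p 0 b = 1 := by
    have h := h1.measure_univ
    rw [densityMeasure_congr hf, densityMeasure_univ (hint.const_mul _)
      fun x => (mul_pos (Real.exp_pos A) (H.tilt_pos b x)).le, ENNReal.ofReal_eq_one,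
      integral_const_mul] at h
    simpa [moment] using h
  rw [temperedMeasure, densityMeasure_congr hf]
  congr 1
  funext x
  rw [H.temperedDensity_eq, eq_div_iff (H.moment_zero_pos hb).ne', mul_right_comm, hA1, one_mul]

/-- Along a gradient flow that starts in a geometric mixture all measures are geometric mixtures,
and the flow reduces to a planar one. -/
theorem exists_reducedFlow_of_isGradientFlow {γ : ℝ → State d} (hγ : IsGradientFlow p₀ p γ)
    {b₀ : ℝ} (hb₀ : b₀ ∈ Set.Icc (0 : ℝ) 1)
    (h0 : ((γ 0).1 : Measure (EuclideanSpace ℝ (Fin d))) = temperedMeasure p₀ p b₀) :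
    ∃ b : ℝ → ℝ, IsReducedFlow (tiltMean p₀ p) (tiltVar p₀ p) b (fun t => ((γ t).2 : ℝ)) ∧
      b 0 = b₀ ∧ ∀ t, 0 ≤ t →
        ((γ t).1 : Measure (EuclideanSpace ℝ (Fin d))) = temperedMeasure p₀ p (b t) := by
  obtain ⟨ρ, hρ, -, hρ', hl'⟩ := hγ
  have hl01 : ∀ t, ((γ t).2 : ℝ) ∈ Set.Icc (0 : ℝ) 1 := fun t => (γ t).2.2
  -- The candidate parameter is built from `l` alone, before the measures are known to be mixtures.
  obtain ⟨b, hb0, hb01, hb'⟩ := exists_relaxation (l := fun t => ((γ t).2 : ℝ))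
    (fun t ht => (hl' t ht).continuousWithinAt) (fun t _ => hl01 t) hb₀
  have hinit : ∀ᵐ x, ρ 0 x = temperedDensity p₀ p b₀ x := by
    have h := (hρ 0 le_rfl).2.2
    refine ae_eq_of_densityMeasure_eq (hρ 0 le_rfl).1 (H.measurable_temperedDensity b₀)
      (hρ 0 le_rfl).2.1 (H.temperedDensity_pos hb₀) ?_ (h.symm.trans h0)
    rw [← h]
    infer_instance
  -- Subtracting the values at a reference point cancels the nonlocal expectation and the
  -- normalising constants, leaving `y' = -y` with `y 0 = 0`. The density at time 0 is determined
  -- only almost everywhere, so `x₀` must be a good point.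
  obtain ⟨x₀, hx₀⟩ := hinit.exists
  have hlog : ∀ x, ρ 0 x = temperedDensity p₀ p b₀ x → ∀ t, 0 ≤ t →
      Real.log (ρ t x) - Real.log (ρ t x₀) - (Real.log (p₀ x) - Real.log (p₀ x₀)) -
        b t * (logRatio p₀ p x - logRatio p₀ p x₀) = 0 := by
    intro x hx t ht
    refine eq_zero_of_deriv_eq_neg (y := fun t => Real.log (ρ t x) - Real.log (ρ t x₀) -
      (Real.log (p₀ x) - Real.log (p₀ x₀)) - b t * (logRatio p₀ p x - logRatio p₀ p x₀))
      (fun s hs => ?_) ?_ ht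
    · have hpos := (hρ s hs).2.1
      refine (((((hρ' s hs x).log (hpos x).ne').sub ((hρ' s hs x₀).log (hpos x₀).ne')).sub_const
        _).sub ((hb' s hs).mul_const _)).congr_deriv ?_
      rw [mul_div_right_comm, mul_div_right_comm, neg_div, neg_div, div_self (hpos x).ne',
        div_self (hpos x₀).ne', H.log_div_temperedDensity (hpos x) (hl01 s),
        H.log_div_temperedDensity (hpos x₀) (hl01 s)]
      ring
    · simp only [hx, hx₀, hb0, H.log_temperedDensity hb₀]
      ring
  have hmix : ∀ t, 0 ≤ t →
      ((γ t).1 : Measure (EuclideanSpace ℝ (Fin d))) = temperedMeasure p₀ p (b t) := by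
    intro t ht
    obtain ⟨-, hpos, hγt⟩ := hρ t ht
    rw [hγt]
    refine H.densityMeasure_eq_temperedMeasure hpos (hb01 t ht)
      (A := Real.log (ρ t x₀) - Real.log (p₀ x₀) - b t * logRatio p₀ p x₀) ?_ ?_
    · filter_upwards [hinit] with x hx
      linarith [hlog x hx t ht]
    · rw [← hγt]
      infer_instance
  refine ⟨b, ⟨hb01, fun t _ => hl01 t, hb', fun t ht => ?_⟩, hb0, hmix⟩
  have h := hl' t ht
  rwa [hmix t ht, H.integral_logRatio (hb01 t ht), H.integral_logRatio (hl01 t),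
    H.variance_log_div (hl01 t)] at h

/-- A solution of the reduced flow gives a gradient flow. -/
theorem isGradientFlow_of_reducedFlow {b l : ℝ → ℝ}
    (hbl : IsReducedFlow (tiltMean p₀ p) (tiltVar p₀ p) b l) {γ : ℝ → State d}
    (hγ₁ : ∀ t, 0 ≤ t →
      ((γ t).1 : Measure (EuclideanSpace ℝ (Fin d))) = temperedMeasure p₀ p (b t))
    (hγ₂ : ∀ t, 0 ≤ t → ((γ t).2 : ℝ) = l t) : IsGradientFlow p₀ p γ := by
  have hpos : ∀ t, 0 ≤ t → ∀ x, 0 < temperedDensity p₀ p (b t) x := fun t ht =>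
    H.temperedDensity_pos (hbl.mem_b t ht)
  have hlog : ∀ t, 0 ≤ t → ∀ x,
      Real.log (temperedDensity p₀ p (b t) x / temperedDensity p₀ p (γ t).2 x) =
        (b t - l t) * logRatio p₀ p x +
          (Real.log (moment p₀ p 0 (l t)) - Real.log (moment p₀ p 0 (b t))) := by
    intro t ht x
    rw [hγ₂ t ht, H.log_div_temperedDensity (hpos t ht x) (hbl.mem_l t ht),
      H.log_temperedDensity (hbl.mem_b t ht)]
    ring
  refine ⟨fun t => temperedDensity p₀ p (b t), fun t ht =>
    ⟨H.measurable_temperedDensity _, hpos t ht, hγ₁ t ht⟩, fun t ht => ?_, fun t ht x => ?_,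
    fun t ht => ?_⟩
  · have := H.isProbabilityMeasure_temperedMeasure (hbl.mem_b t ht)
    have hi := H.integrable_logRatio (hbl.mem_b t ht)
    simp only [hlog t ht, hγ₁ t ht]
    exact ⟨(hi.const_mul _).add (integrable_const _), hi⟩
  · have := H.isProbabilityMeasure_temperedMeasure (hbl.mem_b t ht)
    have hi := H.integrable_logRatio (hbl.mem_b t ht)
    simp only [hlog t ht, hγ₁ t ht]
    rw [integral_add (hi.const_mul _) (integrable_const _), integral_const_mul,
      H.integral_logRatio (hbl.mem_b t ht), integral_const, probReal_univ, one_smul]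
    -- The derivative `m(b)(l - b)` of `log Z(b)` accounts for the expectation term of the
    -- Fisher–Rao equation.
    have h1 := (H.hasDerivWithinAt_log_moment (hbl.mem_b t ht)).comp t (hbl.deriv_b t ht)
      fun s hs => hbl.mem_b s hs
    have h2 := ((((hbl.deriv_b t ht).mul_const (logRatio p₀ p x)).const_add
      (Real.log (p₀ x))).sub h1).exp
    have heq : ∀ s, 0 ≤ s → temperedDensity p₀ p (b s) x = Real.exp (Real.log (p₀ x) +
        b s * logRatio p₀ p x - Real.log (moment p₀ p 0 (b s))) := fun s hs => by
      rw [← H.log_temperedDensity (hbl.mem_b s hs), Real.exp_log (hpos s hs x)]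
    refine (h2.congr heq (heq t ht)).congr_deriv ?_
    simp only [Pi.sub_apply, Function.comp_apply]
    rw [← heq t ht]
    ring
  · rw [hγ₁ t ht, hγ₂ t ht, H.integral_logRatio (hbl.mem_b t ht),
      H.integral_logRatio (hbl.mem_l t ht), H.variance_log_div (hbl.mem_l t ht)]
    exact (hbl.deriv_l t ht).congr (fun s hs => hγ₂ s hs) (hγ₂ t ht)

/-! ### Minimiser, existence, stability and convergence -/

lemma tiltMean_injOn : Set.InjOn (tiltMean p₀ p) (Set.Icc 0 1) :=
  (strictMonoOn_of_reduced (fun _ hb => H.hasDerivWithinAt_tiltMean hb)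
    fun _ hb => H.tiltVar_pos hb).injOn

/-- The mean of the log-ratio is strictly increasing in the parameter and therefore recovers it from
the measure. -/
lemma eq_of_temperedMeasure_eq {b c : ℝ} (hb : b ∈ Set.Icc (0 : ℝ) 1)
    (hc : c ∈ Set.Icc (0 : ℝ) 1) (h : temperedMeasure p₀ p b = temperedMeasure p₀ p c) :
    b = c := by
  refine H.tiltMean_injOn hb hc ?_
  rw [← H.integral_logRatio hb, ← H.integral_logRatio hc, h]

lemma mixture_injective : Function.Injective H.mixture := fun b c h =>
  Subtype.ext (H.eq_of_temperedMeasure_eq b.2 c.2 (congrArg Subtype.val h))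

lemma functional_eq_zero_iff (z : State d) :
    functional p₀ p z = 0 ↔ z = (H.mixture 1, 1) := by
  have h1 : densityMeasure p = temperedMeasure p₀ p 1 := by
    rw [temperedMeasure, H.temperedDensity_one]
  have hz := H.isProbabilityMeasure_temperedMeasure z.2.2
  have hp := H.isProbabilityMeasure_temperedMeasure (Set.right_mem_Icc.2 zero_le_one)
  rw [functional, add_eq_zero, h1, klDiv_eq_zero_iff, klDiv_eq_zero_iff]
  constructor
  · rintro ⟨hμ, hl⟩
    have hl1 : z.2 = 1 := Subtype.ext
      (H.eq_of_temperedMeasure_eq z.2.2 (Set.right_mem_Icc.2 zero_le_one) hl)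
    exact Prod.ext (Subtype.ext (hμ.trans (by rw [hl1]; rfl))) hl1
  · rintro rfl
    exact ⟨rfl, by rw [Set.Icc.coe_one]⟩

theorem exists_trajectory {z : State d} (hz : z ∈ phaseSpace p₀ p) :
    ∃ γ ∈ trajectories p₀ p, γ 0 = z := by
  obtain ⟨b₀, hb₀, hzb⟩ := hz
  obtain ⟨b, l, hbl, hb0, hl0⟩ := exists_reducedFlow
    (fun _ hb => H.hasDerivWithinAt_tiltMean hb) H.continuousOn_tiltVar
    (fun _ hb => H.tiltVar_pos hb) hb₀ z.2.2
  let q : ℝ → I := Set.projIcc 0 1 zero_le_one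
  have hq : ∀ {s : ℝ}, s ∈ Set.Icc (0 : ℝ) 1 → (q s : ℝ) = s := fun h => by
    simp only [q, Set.projIcc_of_mem zero_le_one h]
  have hγ₁ : ∀ t, 0 ≤ t → (H.mixture (q (b t)) : Measure (EuclideanSpace ℝ (Fin d))) =
      temperedMeasure p₀ p (b t) := fun t ht =>
    congrArg (temperedMeasure p₀ p) (hq (hbl.mem_b t ht))
  have hγ0 : ((H.mixture (q (b 0)), q (l 0)) : State d) = z := by
    refine Prod.ext (Subtype.ext ?_) (Subtype.ext ?_)
    · exact (hγ₁ 0 le_rfl).trans (by rw [hb0]; exact hzb.symm)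
    · exact (hq (hbl.mem_l 0 le_rfl)).trans hl0
  refine ⟨fun t => (H.mixture (q (b t)), q (l t)), ⟨H.isGradientFlow_of_reducedFlow hbl hγ₁
    fun t ht => hq (hbl.mem_l t ht), ?_⟩, hγ0⟩
  exact ⟨b 0, hbl.mem_b 0 le_rfl, hγ₁ 0 le_rfl⟩

/-- A weak neighbourhood basis of `(π, 1)` in the phase space in terms of the coordinates. -/
lemma exists_mem_nhds_mixture {ε : ℝ} (hε : 0 < ε) :
    ∃ V ∈ 𝓝 (H.mixture 1), ∀ b : I, H.mixture b ∈ V → 1 - (b : ℝ) < ε := by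
  -- The parameters at distance at least `ε` from 1 form a compact set, so their image is closed in
  -- the Hausdorff weak topology; injectivity keeps `π` out of it.
  have hcl : IsClosed (H.mixture '' {b : I | (b : ℝ) ≤ 1 - ε}) :=
    ((isClosed_le continuous_subtype_val continuous_const).isCompact.image
      H.continuous_mixture).isClosed
  refine ⟨_, hcl.isOpen_compl.mem_nhds ?_, fun b hb => ?_⟩
  · rintro ⟨b, hb, hb1⟩
    rw [H.mixture_injective hb1] at hb
    simp only [Set.mem_ofPred_eq, Set.Icc.coe_one] at hb
    linarith
  · by_contra h
    exact hb ⟨b, show (b : ℝ) ≤ 1 - ε by linarith, rfl⟩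

lemma exists_nhds_coordinates {U : Set (State d)} (hU : U ∈ 𝓝 (H.mixture 1, (1 : I))) :
    ∃ ε > 0, ∀ b l : I, 1 - (b : ℝ) < ε → 1 - (l : ℝ) < ε → (H.mixture b, l) ∈ U := by
  have hc : Continuous fun z : I × I => ((H.mixture z.1, z.2) : State d) :=
    (H.continuous_mixture.comp continuous_fst).prodMk continuous_snd
  obtain ⟨ε, hε, hball⟩ := Metric.mem_nhds_iff.1 (hc.continuousAt.preimage_mem_nhds
    (x := ((1 : I), (1 : I))) hU)
  refine ⟨ε, hε, fun b l hb hl => @hball (b, l) ?_⟩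
  have hd : ∀ c : I, dist c 1 = 1 - (c : ℝ) := fun c => by
    rw [Subtype.dist_eq, Real.dist_eq, Set.Icc.coe_one, abs_sub_comm,
      abs_of_nonneg (sub_nonneg.2 c.2.2)]
  rw [Metric.mem_ball, Prod.dist_eq]
  exact max_lt (by rwa [hd]) (by rwa [hd])

/-- All trajectories approach `(π, 1)` exponentially fast in the coordinates `(b, l)`. -/
theorem exists_trajectory_decay : ∃ a κ : ℝ, 1 ≤ a ∧ 0 < κ ∧ ∀ γ ∈ trajectories p₀ p,
    ∃ b : ℝ → I, (∀ t, 0 ≤ t → (γ t).1 = H.mixture (b t)) ∧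
      ∀ t, 0 ≤ t → max (1 - (b t : ℝ)) (1 - ((γ t).2 : ℝ)) ≤
        Real.exp (-(κ * t)) * max (1 - (b 0 : ℝ)) (a * (1 - ((γ 0).2 : ℝ))) := by
  obtain ⟨a, κ, ha, hκ, hdecay⟩ := exists_exponential_decay
    (fun _ hb => H.hasDerivWithinAt_tiltMean hb) H.continuousOn_tiltVar
    (fun _ hb => H.tiltVar_pos hb)
  refine ⟨a, κ, ha, hκ, fun γ hγ => ?_⟩
  obtain ⟨hflow, b₀, hb₀, h0⟩ := hγ
  obtain ⟨b, hbl, -, hb⟩ := H.exists_reducedFlow_of_isGradientFlow hflow hb₀ h0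
  have hq : ∀ t, 0 ≤ t → ((Set.projIcc 0 1 zero_le_one (b t) : I) : ℝ) = b t := fun t ht => by
    rw [Set.projIcc_of_mem zero_le_one (hbl.mem_b t ht)]
  refine ⟨fun t => Set.projIcc 0 1 zero_le_one (b t), fun t ht => Subtype.ext ?_,
    fun t ht => ?_⟩
  · exact (hb t ht).trans (congrArg (temperedMeasure p₀ p) (hq t ht).symm)
  · rw [hq t ht, hq 0 le_rfl]
    refine le_trans (max_le_max le_rfl ?_) (hdecay b _ hbl t ht)
    exact le_mul_of_one_le_left (sub_nonneg.2 (γ t).2.2.2) ha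

theorem tendsto_of_mem_trajectories {γ : ℝ → State d} (hγ : γ ∈ trajectories p₀ p) :
    Tendsto γ atTop (𝓝 (H.mixture 1, 1)) := by
  obtain ⟨a, κ, -, hκ, h⟩ := H.exists_trajectory_decay
  obtain ⟨b, hb, hdecay⟩ := h γ hγ
  have hlim : Tendsto (fun t => Real.exp (-(κ * t)) *
      max (1 - (b 0 : ℝ)) (a * (1 - ((γ 0).2 : ℝ)))) atTop (𝓝 0) := by
    have := (Real.tendsto_exp_neg_atTop_nhds_zero.comp
      (tendsto_id.const_mul_atTop hκ)).mul_const
        (max (1 - (b 0 : ℝ)) (a * (1 - ((γ 0).2 : ℝ))))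
    simpa using this
  refine fun U hU => mem_map.2 ?_
  obtain ⟨ε, hε, hUε⟩ := H.exists_nhds_coordinates hU
  filter_upwards [hlim.eventually (gt_mem_nhds hε), eventually_ge_atTop (0 : ℝ)] with t ht ht0
  have hlt := max_lt_iff.1 ((hdecay t ht0).trans_lt ht)
  have := hUε (b t) (γ t).2 hlt.1 hlt.2
  rwa [← hb t ht0] at this

theorem isAsymptoticallyStable :
    IsAsymptoticallyStable (trajectories p₀ p) (H.mixture 1, (1 : I)) := by
  refine ⟨fun U hU => ?_, Set.univ, univ_mem, fun γ hγ _ => H.tendsto_of_mem_trajectories hγ⟩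
  obtain ⟨a, κ, ha, hκ, h⟩ := H.exists_trajectory_decay
  obtain ⟨ε, hε, hUε⟩ := H.exists_nhds_coordinates hU
  obtain ⟨V, hV, hVε⟩ := H.exists_mem_nhds_mixture hε
  have ha0 : 0 < a := zero_lt_one.trans_le ha
  -- The weight `a` enters the neighbourhood because the initial value in the decay estimate carries
  -- it.
  have hW : {l : I | a * (1 - (l : ℝ)) < ε} ∈ 𝓝 (1 : I) :=
    (isOpen_lt (by fun_prop) continuous_const).mem_nhds (by simpa using hε)
  refine ⟨V ×ˢ {l : I | a * (1 - (l : ℝ)) < ε}, prod_mem_nhds hV hW, fun γ hγ hγ0 t ht => ?_⟩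
  obtain ⟨b, hb, hdecay⟩ := h γ hγ
  have h1 : 1 - (b 0 : ℝ) < ε := hVε _ (hb 0 le_rfl ▸ hγ0.1)
  have h2 : max (1 - (b 0 : ℝ)) (a * (1 - ((γ 0).2 : ℝ))) < ε := max_lt h1 hγ0.2
  have h3 : 0 ≤ max (1 - (b 0 : ℝ)) (a * (1 - ((γ 0).2 : ℝ))) :=
    le_max_of_le_left (sub_nonneg.2 (b 0).2.2)
  have h4 : Real.exp (-(κ * t)) ≤ 1 := Real.exp_le_one_iff.2 (by nlinarith)
  have hlt := max_lt_iff.1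
    (((hdecay t ht).trans (mul_le_of_le_one_left h3 h4)).trans_lt h2)
  have := hUε (b t) (γ t).2 hlt.1 hlt.2
  rwa [← hb t ht] at this

end IsTemperingPair

/-! ### Gibbs densities form a tempering pair -/

lemma gibbs_pos (V : EuclideanSpace ℝ (Fin d) → ℝ) (x : EuclideanSpace ℝ (Fin d)) :
    0 < gibbs V x := Real.exp_pos _

lemma measurable_gibbs {V : EuclideanSpace ℝ (Fin d) → ℝ} (hV : Continuous V) :
    Measurable (gibbs V) := (Real.continuous_exp.comp hV.neg).measurable

lemma integrable_of_isProbabilityMeasure_densityMeasure {f : EuclideanSpace ℝ (Fin d) → ℝ}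
    (hf : Measurable f) (hf0 : ∀ x, 0 ≤ f x) (h : IsProbabilityMeasure (densityMeasure f)) :
    Integrable f ∧ ∫ x, f x = 1 := by
  have h1 : Integrable f := by
    simpa using (integrable_densityMeasure_iff hf hf0).1 (integrable_const (1 : ℝ))
  refine ⟨h1, ?_⟩
  have := h.measure_univ
  rwa [densityMeasure_univ h1 hf0, ENNReal.ofReal_eq_one] at this

lemma isTemperingPair_gibbs {V₀ V : EuclideanSpace ℝ (Fin d) → ℝ} (hV₀ : Continuous V₀)
    (hV : Continuous V) {μ₀ π : ProbabilityMeasure (EuclideanSpace ℝ (Fin d))}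
    (hμ₀ : (μ₀ : Measure (EuclideanSpace ℝ (Fin d))) = densityMeasure (gibbs V₀))
    (hπ : (π : Measure (EuclideanSpace ℝ (Fin d))) = densityMeasure (gibbs V))
    (hne : μ₀ ≠ π)
    (hg₀ : MemLp (logRatio (gibbs V₀) (gibbs V)) 2 (μ₀ : Measure (EuclideanSpace ℝ (Fin d))))
    (hg : MemLp (logRatio (gibbs V₀) (gibbs V)) 2 (π : Measure (EuclideanSpace ℝ (Fin d)))) :
    IsTemperingPair (gibbs V₀) (gibbs V) := by
  have hm₀ := measurable_gibbs hV₀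
  have hm := measurable_gibbs hV
  have hp₀ := integrable_of_isProbabilityMeasure_densityMeasure hm₀
    (fun x => (gibbs_pos V₀ x).le) (hμ₀ ▸ μ₀.2)
  have hp := integrable_of_isProbabilityMeasure_densityMeasure hm
    (fun x => (gibbs_pos V x).le) (hπ ▸ π.2)
  refine ⟨hm₀, hm, gibbs_pos V₀, gibbs_pos V, hp₀.1, hp.1, hp₀.2, hp.2, ?_, ?_, fun h => hne ?_⟩
  · rw [hμ₀] at hg₀
    exact (integrable_densityMeasure_iff hm₀ fun x => (gibbs_pos V₀ x).le).1 hg₀.integrable_sq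
  · rw [hπ] at hg
    exact (integrable_densityMeasure_iff hm fun x => (gibbs_pos V x).le).1 hg.integrable_sq
  · exact Subtype.ext (hμ₀.trans (h.trans hπ.symm))

end TemperedFR

end

theorem proposition6 (d : ℕ) (V₀ V : EuclideanSpace ℝ (Fin d) → ℝ)
    (hV₀ : ContDiff ℝ 1 V₀) (hV : ContDiff ℝ 1 V)
    (μ₀ π : ProbabilityMeasure (EuclideanSpace ℝ (Fin d)))
    (hμ₀ : (μ₀ : Measure (EuclideanSpace ℝ (Fin d))) =
      TemperedFR.densityMeasure (TemperedFR.gibbs V₀))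
    (hπ : (π : Measure (EuclideanSpace ℝ (Fin d))) =
      TemperedFR.densityMeasure (TemperedFR.gibbs V))
    (hne : μ₀ ≠ π)
    (hg₀ : MemLp (TemperedFR.logRatio (TemperedFR.gibbs V₀) (TemperedFR.gibbs V)) 2
      (μ₀ : Measure (EuclideanSpace ℝ (Fin d))))
    (hg : MemLp (TemperedFR.logRatio (TemperedFR.gibbs V₀) (TemperedFR.gibbs V)) 2
      (π : Measure (EuclideanSpace ℝ (Fin d)))) :
    -- `(π, 1)` is the unique minimiser, with minimum value zero
    (TemperedFR.functional (TemperedFR.gibbs V₀) (TemperedFR.gibbs V) (π, 1) = 0 ∧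
      ∀ z : TemperedFR.State d, z ≠ (π, 1) →
        TemperedFR.functional (TemperedFR.gibbs V₀) (TemperedFR.gibbs V) (π, 1) <
          TemperedFR.functional (TemperedFR.gibbs V₀) (TemperedFR.gibbs V) z) ∧
    -- from every state of the phase space starts a global solution with values in `𝒫 × [0,1]`
    (∀ z ∈ TemperedFR.phaseSpace (TemperedFR.gibbs V₀) (TemperedFR.gibbs V),
      ∃ γ ∈ TemperedFR.trajectories (TemperedFR.gibbs V₀) (TemperedFR.gibbs V), γ 0 = z) ∧
    -- `(π, 1)` is asymptotically stable
    TemperedFR.IsAsymptoticallyStable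
      (TemperedFR.trajectories (TemperedFR.gibbs V₀) (TemperedFR.gibbs V)) (π, 1) ∧
    -- `(μ_t, l_t) → (π, 1)` along every solution that starts in the phase space
    (∀ γ ∈ TemperedFR.trajectories (TemperedFR.gibbs V₀) (TemperedFR.gibbs V),
      Tendsto γ atTop (𝓝 (π, 1))) ∧
    -- in particular along every solution that starts at `(μ₀, l)`, `l ∈ [0,1]`
    (∀ γ, TemperedFR.IsGradientFlow (TemperedFR.gibbs V₀) (TemperedFR.gibbs V) γ →
      (γ 0).1 = μ₀ → Tendsto γ atTop (𝓝 (π, 1))) := by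
  have H := TemperedFR.isTemperingPair_gibbs hV₀.continuous hV.continuous hμ₀ hπ hne hg₀ hg
  have hπ1 : H.mixture 1 = π := Subtype.ext
    ((congrArg TemperedFR.densityMeasure H.temperedDensity_one).trans hπ.symm)
  rw [← hπ1]
  have h0 := (H.functional_eq_zero_iff _).2 rfl
  refine ⟨⟨h0, fun z hz => ?_⟩, fun z hz => H.exists_trajectory hz, H.isAsymptoticallyStable,
    fun γ hγ => H.tendsto_of_mem_trajectories hγ,
    fun γ hγ hγ0 => H.tendsto_of_mem_trajectories ⟨hγ, 0, Set.left_mem_Icc.2 zero_le_one, ?_⟩⟩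
  · rw [h0]
    exact pos_iff_ne_zero.2 fun h => hz ((H.functional_eq_zero_iff z).1 h)
  · rw [hγ0, hμ₀, TemperedFR.temperedMeasure, H.temperedDensity_zero]
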